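/- A gauged measure space (gm-space) is a triple $\mathbb X=(X,g,\xi)$ of a Polish space $X$, a Borel probability measure $\xi$ on $X$ and a symmetric function $g\in L^2(X\times X,\xi\otimes\xi)$. For gm-spaces $\mathbb X=(X,g,\xi)$ and $\mathbb Y=(Y,h,\upsilon)$ let $\Pi(\mathbb X,\mathbb Y)$ be the set of Borel probability measures on $X\times Y$ with marginals $\xi$ and $\upsilon$, let $$\mathrm{GW}(\mathbb X,\mathbb Y)=\inf_{\pi\in\Pi(\mathbb X,\mathbb Y)}\Bigl(\iint |g(x,x')-h(y,y')|^2\,d\pi(x,y)\,d\pi(x',y')\Bigr)^{1/2},$$ and let $\Pi_{\mathrm o}(\mathbb X,\mathbb Y)$ be the set of plans that attain this infimum. Let $\mathfrak{GM}$ be the set of classes $[\![\mathbb X]\!]$ of gm-spaces modulo $\mathrm{GW}(\mathbb X,\mathbb Y)=0$, equipped with the metric induced by $\mathrm{GW}$. Fix $\mathfrak X_1,\dots,\mathfrak X_N\in\mathfrak{GM}$ and weights $\rho\in\Delta_{N-1}=\{\rho\in[0,1]^N:\sum_{i}\rho_i=1\}$. For $\mathfrak Y\in\mathfrak{GM}$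 let $\widetilde{\mathrm{TB}}_\rho(\mathfrak Y)\subset\mathfrak{GM}$ be the set of all classes $$\Bigl[\!\Bigl[\bigl(X_1\times\dots\times X_N,\ m_\rho,\ (P_{X_1\times\dots\times X_N})_\#\gamma\bigr)\Bigr]\!\Bigr],\qquad m_\rho(x,x')=\sum_{i=1}^N\rho_i\,g_i(x_i,x_i'),$$ where $\mathbb X_i=(X_i,g_i,\xi_i)\in\mathfrak X_i$ and $\mathbb Y=(Y,h,\upsilon)\in\mathfrak Y$ are representatives and $\gamma$ is a Borel probability measure on $Y\times X_1\times\dots\times X_N$ with $(P_{Y\times X_i})_\#\gamma\in\Pi_{\mathrm o}(\mathbb Y,\mathbb X_i)$ for all $i=1,\dots,N$. Theorem. Let $(\mathfrak Y_n)_{n\in\mathbb N}$ be a sequence in $\mathfrak{GM}$ with $\mathfrak Y_{n+1}\in\widetilde{\mathrm{TB}}_\rho(\mathfrak Y_n)$ for all $n$. Then every subsequence of $(\mathfrak Y_n)$ has a further subsequence that converges in $(\mathfrak{GM},\mathrm{GW})$ to some $\mathfrak Y\in\mathfrak{GM}$ with $\mathfrak Y\in\widetilde{\mathrm{TB}}_\rho(\mathfrak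 Y)$. -/

import Mathlib

open MeasureTheory ProbabilityTheory Filter Topology

universe u

noncomputable section

/-- A gauged measure space `(X, g, ξ)`: a Polish space `X` with its Borel `σ`-algebra, a Borel
probability measure `ξ` and a symmetric gauge `g` that is square integrable with respect to
`ξ ⊗ ξ`. -/
structure GMSpace : Type (u + 1) where
  carrier : Type u
  [top : TopologicalSpace carrier]
  [polish : PolishSpace carrier]
  [meas : MeasurableSpace carrier]
  [borel : BorelSpace carrier]
  ξ : Measure carrier
  [prob : IsProbabilityMeasure ξ]
  g : carrier → carrier → ℝ
  symm : ∀ x x', g x x' = g x' x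
  memLp : MemLp (fun p : carrier × carrier => g p.1 p.2) 2 (ξ.prod ξ)

namespace GMSpace

attribute [instance] top polish meas borel prob

/-- The transport plans `Π(𝕏, 𝕐)`. -/
def plans (X Y : GMSpace.{u}) : Set (Measure (X.carrier × Y.carrier)) :=
  {π | IsProbabilityMeasure π ∧ π.map Prod.fst = X.ξ ∧ π.map Prod.snd = Y.ξ}

/-- The GW functional `‖g(x,x') - h(y,y')‖` in `L²(π(x,y) ⊗ π(x',y'))`. -/
def gwFun (X Y : GMSpace.{u}) (π : Measure (X.carrier × Y.carrier)) : ℝ :=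
  (eLpNorm (fun p : (X.carrier × Y.carrier) × (X.carrier × Y.carrier) =>
    X.g p.1.1 p.2.1 - Y.g p.1.2 p.2.2) 2 (π.prod π)).toReal

/-- The Gromov--Wasserstein distance `GW₂`. -/
def gw (X Y : GMSpace.{u}) : ℝ := sInf (gwFun X Y '' plans X Y)

/-- The optimal transport plans `Π_o(𝕏, 𝕐)`. -/
def optPlans (X Y : GMSpace.{u}) : Set (Measure (X.carrier × Y.carrier)) :=
  {π | π ∈ plans X Y ∧ gwFun X Y π = gw X Y}

/-! ### `gw` is a pseudometric -/

instance nonempty_carrier (X : GMSpace.{u}) : Nonempty X.carrier := X.ξ.nonempty_of_neZero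

theorem measurePreserving_prodMap {A B : Type*} [MeasurableSpace A] [MeasurableSpace B]
    {α : Measure A} {β : Measure B} [SFinite α] [SFinite β] {f : A → B} (hf : Measurable f)
    (h : α.map f = β) :
    MeasurePreserving (fun p : A × A => (f p.1, f p.2)) (α.prod α) (β.prod β) :=
  (MeasurePreserving.mk hf h).prod (MeasurePreserving.mk hf h)

theorem memLp_pullback (X : GMSpace.{u}) {A : Type*} [MeasurableSpace A] {α : Measure A}
    [SFinite α] {f : A → X.carrier} (hf : Measurable f) (h : α.map f = X.ξ) :
    MemLp (fun p : A × A => X.g (f p.1) (f p.2)) 2 (α.prod α) :=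
  X.memLp.comp_measurePreserving (measurePreserving_prodMap hf h)

theorem gwFun_map (X Y : GMSpace.{u}) {A : Type*} [MeasurableSpace A] {α : Measure A}
    [IsProbabilityMeasure α] {f : A → X.carrier} {k : A → Y.carrier} (hf : Measurable f)
    (hk : Measurable k) (h : α.map f = X.ξ) (h' : α.map k = Y.ξ) :
    α.map (fun a => (f a, k a)) ∈ plans X Y ∧
    gwFun X Y (α.map fun a => (f a, k a)) =
      (eLpNorm (fun p : A × A => X.g (f p.1) (f p.2) - Y.g (k p.1) (k p.2)) 2
        (α.prod α)).toReal := by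
  have hm : Measurable fun a => (f a, k a) := hf.prodMk hk
  have := Measure.isProbabilityMeasure_map (μ := α) hm.aemeasurable
  have h1 : (α.map fun a => (f a, k a)).map Prod.fst = X.ξ := by
    rw [Measure.map_map measurable_fst hm]; exact h
  have h2 : (α.map fun a => (f a, k a)).map Prod.snd = Y.ξ := by
    rw [Measure.map_map measurable_snd hm]; exact h'
  refine ⟨⟨this, h1, h2⟩, ?_⟩
  exact congrArg ENNReal.toReal (eLpNorm_comp_measurePreserving
    ((X.memLp_pullback measurable_fst h1).sub
      (Y.memLp_pullback measurable_snd h2)).aestronglyMeasurable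
    (measurePreserving_prodMap hm rfl)).symm

theorem bddBelow_gwFun (X Y : GMSpace.{u}) : BddBelow (gwFun X Y '' plans X Y) :=
  ⟨0, by rintro _ ⟨π, _, rfl⟩; exact ENNReal.toReal_nonneg⟩

theorem nonempty_gwFun (X Y : GMSpace.{u}) : (gwFun X Y '' plans X Y).Nonempty :=
  ⟨_, X.ξ.prod Y.ξ, ⟨inferInstance, by simp, by simp⟩, rfl⟩

theorem gw_le (X Y : GMSpace.{u}) {π : Measure (X.carrier × Y.carrier)} (h : π ∈ plans X Y) :
    gw X Y ≤ gwFun X Y π :=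
  csInf_le (bddBelow_gwFun X Y) ⟨π, h, rfl⟩

theorem gw_nonneg (X Y : GMSpace.{u}) : 0 ≤ gw X Y :=
  Real.sInf_nonneg (by rintro _ ⟨π, _, rfl⟩; exact ENNReal.toReal_nonneg)

theorem gw_self (X : GMSpace.{u}) : gw X X = 0 := by
  obtain ⟨h1, h2⟩ := gwFun_map X X (α := X.ξ) measurable_id measurable_id Measure.map_id
    Measure.map_id
  refine le_antisymm ((gw_le X X h1).trans (le_of_eq ?_)) (gw_nonneg X X)
  rw [h2]
  simp

theorem gw_comm_le (X Y : GMSpace.{u}) : gw X Y ≤ gw Y X := by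
  refine le_csInf (nonempty_gwFun Y X) ?_
  rintro _ ⟨π, ⟨hp, h1, h2⟩, rfl⟩
  obtain ⟨h3, h4⟩ := gwFun_map X Y (α := π) measurable_snd measurable_fst h2 h1
  refine (gw_le X Y h3).trans (le_of_eq ?_)
  rw [h4, gwFun, ← eLpNorm_neg]
  congr 2
  ext p
  simp

/-- Gluing of two plans along their common marginal. -/
theorem exists_gluing (X Y Z : GMSpace.{u}) {π : Measure (X.carrier × Y.carrier)}
    {σ : Measure (Y.carrier × Z.carrier)} (hπ : π ∈ plans X Y) (hσ : σ ∈ plans Y Z) :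
    ∃ γ : Measure ((X.carrier × Y.carrier) × Z.carrier), IsProbabilityMeasure γ ∧
      γ.map Prod.fst = π ∧ γ.map (fun p => (p.1.2, p.2)) = σ := by
  obtain ⟨hp, -, h2⟩ := hπ
  obtain ⟨hs, h3, -⟩ := hσ
  have hm : Measurable fun p : (X.carrier × Y.carrier) × Z.carrier => (p.1.2, p.2) := by
    fun_prop
  refine ⟨π ⊗ₘ (σ.condKernel.comap Prod.snd measurable_snd), inferInstance,
    Measure.fst_compProd _ _, ?_⟩
  ext s hs
  rw [Measure.map_apply hm hs, Measure.compProd_apply (hm hs)]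
  conv_rhs => rw [← σ.disintegrate σ.condKernel, Measure.compProd_apply hs, Measure.fst, h3, ← h2,
    lintegral_map (Kernel.measurable_kernel_prodMk_left hs) measurable_snd]
  rfl

theorem gw_triangle (X Y Z : GMSpace.{u}) : gw X Z ≤ gw X Y + gw Y Z := by
  have key : ∀ π ∈ plans X Y, ∀ σ ∈ plans Y Z, gw X Z ≤ gwFun X Y π + gwFun Y Z σ := by
    intro π hπ σ hσ
    obtain ⟨γ, hγ, h1, h2⟩ := exists_gluing X Y Z hπ hσ
    have mX : Measurable fun p : (X.carrier × Y.carrier) × Z.carrier => p.1.1 := by fun_prop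
    have mY : Measurable fun p : (X.carrier × Y.carrier) × Z.carrier => p.1.2 := by fun_prop
    have mZ : Measurable fun p : (X.carrier × Y.carrier) × Z.carrier => p.2 := by fun_prop
    have eX : γ.map (fun p => p.1.1) = X.ξ := by
      rw [← hπ.2.1, ← h1, Measure.map_map measurable_fst measurable_fst]; rfl
    have eY : γ.map (fun p => p.1.2) = Y.ξ := by
      rw [← hπ.2.2, ← h1, Measure.map_map measurable_snd measurable_fst]; rfl
    have eZ : γ.map (fun p => p.2) = Z.ξ := by
      rw [← hσ.2.2, ← h2, Measure.map_map measurable_snd (mY.prodMk mZ)]; rfl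
    obtain ⟨a1, a2⟩ := gwFun_map X Z mX mZ eX eZ
    have b2 := (gwFun_map X Y mX mY eX eY).2
    have c2 := (gwFun_map Y Z mY mZ eY eZ).2
    have b1 : γ.map (fun p => (p.1.1, p.1.2)) = π := h1
    rw [b1] at b2
    rw [h2] at c2
    have LX := X.memLp_pullback mX eX
    have LY := Y.memLp_pullback mY eY
    have LZ := Z.memLp_pullback mZ eZ
    refine (gw_le X Z a1).trans ?_
    rw [a2, b2, c2]
    refine le_of_le_of_eq ?_
      (ENNReal.toReal_add (LX.sub LY).eLpNorm_ne_top (LY.sub LZ).eLpNorm_ne_top)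
    refine ENNReal.toReal_mono
      (ENNReal.add_ne_top.2 ⟨(LX.sub LY).eLpNorm_ne_top, (LY.sub LZ).eLpNorm_ne_top⟩) ?_
    refine le_trans (le_of_eq ?_) (eLpNorm_add_le (LX.sub LY).aestronglyMeasurable
      (LY.sub LZ).aestronglyMeasurable (by norm_num))
    congr 1
    ext p
    simp
  have h1 : ∀ σ ∈ plans Y Z, gw X Z - gwFun Y Z σ ≤ gw X Y := fun σ hσ =>
    le_csInf (nonempty_gwFun X Y) (by
      rintro _ ⟨π, hπ, rfl⟩
      linarith [key π hπ σ hσ])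
  have h2 : gw X Z - gw X Y ≤ gw Y Z :=
    le_csInf (nonempty_gwFun Y Z) (by
      rintro _ ⟨σ, hσ, rfl⟩
      linarith [h1 σ hσ])
  linarith

instance : PseudoMetricSpace GMSpace.{u} where
  dist := gw
  dist_self := gw_self
  dist_comm X Y := le_antisymm (gw_comm_le X Y) (gw_comm_le Y X)
  dist_triangle := gw_triangle

end GMSpace

/-- The space of homomorphic gm-spaces: gm-spaces modulo `gw 𝕏 𝕐 = 0`, with the metric induced
by `gw`. -/
abbrev GM : Type (u + 1) := SeparationQuotient GMSpace.{u}

/-- The homomorphic equivalence class `⟦𝕏⟧`. -/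
def GMSpace.toGM (X : GMSpace.{u}) : GM.{u} := SeparationQuotient.mk X

theorem GMSpace.toGM_eq_iff (X Y : GMSpace.{u}) : X.toGM = Y.toGM ↔ GMSpace.gw X Y = 0 :=
  SeparationQuotient.mk_eq_mk.trans Metric.inseparable_iff

theorem GMSpace.dist_toGM (X Y : GMSpace.{u}) : dist X.toGM Y.toGM = GMSpace.gw X Y := rfl

namespace GMSpace

variable {N : ℕ}

/-- The multi-marginal transport plans `Π(𝕏₁, …, 𝕏_N)`. -/
def multiPlans (X : Fin N → GMSpace.{u}) : Set (Measure (∀ i, (X i).carrier)) :=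
  {μ | IsProbabilityMeasure μ ∧ ∀ i, μ.map (fun x => x i) = (X i).ξ}

/-- The multi-marginal gluings `Γ_𝕐(π₁, …, π_N)` along `𝕐`. -/
def gluings (Y : GMSpace.{u}) (X : Fin N → GMSpace.{u})
    (π : ∀ i, Measure (Y.carrier × (X i).carrier)) :
    Set (Measure (Y.carrier × ∀ i, (X i).carrier)) :=
  {γ | IsProbabilityMeasure γ ∧ ∀ i, γ.map (fun p => (p.1, p.2 i)) = π i}

/-- The multi-marginal meltings `M_𝕐(π₁, …, π_N)` along `𝕐`. -/
def meltings (Y : GMSpace.{u}) (X : Fin N → GMSpace.{u})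
    (π : ∀ i, Measure (Y.carrier × (X i).carrier)) : Set (Measure (∀ i, (X i).carrier)) :=
  (fun γ => γ.map Prod.snd) '' gluings Y X π

/-- The optimal meltings `M^o_𝕐(𝕏₁, …, 𝕏_N)`. -/
def optMeltings (Y : GMSpace.{u}) (X : Fin N → GMSpace.{u}) :
    Set (Measure (∀ i, (X i).carrier)) :=
  {μ | ∃ π : ∀ i, Measure (Y.carrier × (X i).carrier),
    (∀ i, π i ∈ optPlans Y (X i)) ∧ μ ∈ meltings Y X π}

theorem optMeltings_subset (Y : GMSpace.{u}) (X : Fin N → GMSpace.{u}) :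
    optMeltings Y X ⊆ multiPlans X := by
  rintro _ ⟨π, hπ, γ, ⟨hγ, h⟩, rfl⟩
  refine ⟨Measure.isProbabilityMeasure_map measurable_snd.aemeasurable, fun i => ?_⟩
  have hm : Measurable fun p : Y.carrier × (∀ i, (X i).carrier) => (p.1, p.2 i) := by fun_prop
  rw [← (hπ i).1.2.2, ← h i, Measure.map_map measurable_snd hm]
  exact Measure.map_map (measurable_pi_apply i) measurable_snd

/-- The gm-space `(X_×, m_ρ, μ)` over the product `X_×` of the domains, with the mean gauge
`m_ρ(x, x') = ∑ i, ρ i * g i (x i) (x' i)` and `μ ∈ Π(𝕏₁, …, 𝕏_N)`. -/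
def meanSpace (X : Fin N → GMSpace.{u}) (ρ : Fin N → ℝ) (μ : Measure (∀ i, (X i).carrier))
    (hμ : μ ∈ multiPlans X) : GMSpace.{u} :=
  haveI := hμ.1
  { carrier := ∀ i, (X i).carrier
    ξ := μ
    g := fun x x' => ∑ i, ρ i * (X i).g (x i) (x' i)
    symm := fun x x' => Finset.sum_congr rfl fun i _ => by rw [(X i).symm]
    memLp := memLp_finsetSum _ fun i _ =>
      ((X i).memLp_pullback (measurable_pi_apply i) (hμ.2 i)).const_mul (ρ i) }

end GMSpace

/-- The relaxed tangential barycenter map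
`T̃B_ρ(𝔜) = {⟦(X_×, m_ρ, μ)⟧ : μ ∈ M^o_𝔜(𝕏₁, …, 𝕏_N)}` with respect to `𝔛₁, …, 𝔛_N`,
where `𝕐` and `𝕏ᵢ` range over the representatives of `𝔜` and `𝔛ᵢ`. -/
def relaxedTB {N : ℕ} (ρ : Fin N → ℝ) (𝔛 : Fin N → GM.{u}) (𝔜 : GM.{u}) : Set GM.{u} :=
  {ℨ | ∃ (X : Fin N → GMSpace.{u}) (Y : GMSpace.{u}), (∀ i, (X i).toGM = 𝔛 i) ∧ Y.toGM = 𝔜 ∧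
    ∃ (μ : Measure (∀ i, (X i).carrier)) (hμ : μ ∈ GMSpace.optMeltings Y X),
      ℨ = (GMSpace.meanSpace X ρ μ (GMSpace.optMeltings_subset Y X hμ)).toGM}

end

/-!
Write `B 𝔜 = ∑ i, ρ i * dist 𝔜 (𝔛 i) ^ 2`. Along an optimal gluing all gauges live in one `L²`
space, where the parallel axis identity shows that passing from `𝔜` to `ℨ ∈ relaxedTB ρ 𝔛 𝔜` lowers
`B` by at least `dist 𝔜 ℨ ^ 2`. Hence consecutive iterates become arbitrarily close, and it remains
to see that `relaxedTB ρ 𝔛` has relatively compact range and closed graph.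

Both follow from the weak compactness of the set of joint plans with given marginals, once the
gauges are known to vary continuously with the plan in `L²`. Gauges are merely measurable, so weak
convergence does not give this directly. Instead, each gauge is approximated in `L²` by a step
kernel, which is constant on the cells of a finite measurable partition. With the marginals fixed,
the masses of measurable rectangles are lower semicontinuous in the plan, so that plans weakly close
to each other can be coupled in such a way that each coordinate rarely changes its cell.
-/

/-! ### Step kernels -/

/-- A kernel on `X` which factors through the square of a finite measurable partition of `X`; the
partition is given by a measurable map `q : X → Fin n`. For `β = Prop` these are the finite unions
of rectangles of such a square. -/
def IsStepKernel {X β : Type*} [MeasurableSpace X] (f : X × X → β) : Prop :=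
  ∃ (n : ℕ) (q : X → Fin n) (G : Fin n × Fin n → β), Measurable q ∧ f = G ∘ Prod.map q q

namespace IsStepKernel

variable {X β β' β'' : Type*} [MeasurableSpace X]

theorem of_finite {F : Type*} [Finite F] [MeasurableSpace F] [DiscreteMeasurableSpace F]
    {q : X → F} (hq : Measurable q) (G : F × F → β) : IsStepKernel (G ∘ Prod.map q q) :=
  let e := Finite.equivFin F
  ⟨Nat.card F, e ∘ q, G ∘ Prod.map e.symm e.symm, Measurable.of_discrete.comp hq, by
    ext; simp [Prod.map, e]⟩

theorem map {f : X × X → β} (hf : IsStepKernel f) (Φ : β → β') :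
    IsStepKernel fun p => Φ (f p) := by
  obtain ⟨n, q, G, hq, rfl⟩ := hf
  exact ⟨n, q, Φ ∘ G, hq, rfl⟩

theorem map₂ {f : X × X → β} {f' : X × X → β'} (hf : IsStepKernel f) (hf' : IsStepKernel f')
    (Φ : β → β' → β'') : IsStepKernel fun p => Φ (f p) (f' p) := by
  obtain ⟨n, q, G, hq, rfl⟩ := hf
  obtain ⟨n', q', G', hq', rfl⟩ := hf'
  exact of_finite (hq.prodMk hq') fun s => Φ (G (s.1.1, s.2.1)) (G' (s.1.2, s.2.2))

theorem measurable [MeasurableSpace β] {f : X × X → β} (hf : IsStepKernel f) : Measurable f := by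
  obtain ⟨n, q, G, hq, rfl⟩ := hf
  exact Measurable.of_discrete.comp (hq.prodMap hq)

theorem stronglyMeasurable [TopologicalSpace β] {f : X × X → β} (hf : IsStepKernel f) :
    StronglyMeasurable f := by
  obtain ⟨n, q, G, hq, rfl⟩ := hf
  exact StronglyMeasurable.of_discrete.comp_measurable (hq.prodMap hq)

theorem isSetAlgebra (X : Type*) [MeasurableSpace X] :
    IsSetAlgebra {A : Set (X × X) | IsStepKernel fun p => p ∈ A} where
  empty_mem := of_finite (measurable_const (a := ())) fun _ => False
  compl_mem _ hA := hA.map Not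
  union_mem _ _ hA hB := hA.map₂ hB Or

theorem generateFrom_eq (X : Type*) [MeasurableSpace X] :
    (Prod.instMeasurableSpace : MeasurableSpace (X × X)) =
      .generateFrom {A | IsStepKernel fun p => p ∈ A} := by
  apply le_antisymm
  · rw [← generateFrom_prod]
    apply MeasurableSpace.generateFrom_mono
    rintro _ ⟨s, hs, t, ht, rfl⟩
    exact (of_finite (measurable_mem.2 hs) Prod.fst).map₂
      (of_finite (measurable_mem.2 ht) Prod.snd) And
  · exact MeasurableSpace.generateFrom_le fun A hA => measurable_mem.1 hA.measurable

theorem exists_eLpNorm_sub_le {E : Type*} [NormedAddCommGroup E] {μ : Measure (X × X)}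
    [IsFiniteMeasure μ] {p : ENNReal} (hp : p ≠ ⊤) {f : X × X → E} (hf : MemLp f p μ)
    {ε : ENNReal} (hε : ε ≠ 0) : ∃ g, eLpNorm (f - g) p μ ≤ ε ∧ IsStepKernel g := by
  classical
  refine hf.induction_dense hp IsStepKernel (fun c s hs _ ε hε => ?_)
    (fun f g hf hg => hf.map₂ hg (· + ·)) (fun g hg => hg.stronglyMeasurable.aestronglyMeasurable)
    hε
  have dense : μ.MeasureDense {A | IsStepKernel fun p => p ∈ A} :=
    .of_generateFrom_isSetAlgebra_finite μ (isSetAlgebra X) (generateFrom_eq X)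
  obtain ⟨η, η_pos, hη⟩ := exists_eLpNorm_indicator_le hp c hε
  obtain ⟨t, ht, hst⟩ := dense.approx s hs (measure_ne_top _ _) η (by exact_mod_cast η_pos)
  refine ⟨t.indicator fun _ => c, ?_, ht.map fun h => if h then c else 0⟩
  refine le_trans (eLpNorm_mono fun x => ?_) (hη (symmDiff s t) (by simpa using hst.le))
  by_cases hs : x ∈ s <;> by_cases ht : x ∈ t <;> simp [hs, ht, Set.mem_symmDiff]

end IsStepKernel

/-! ### Couplings close to the diagonal -/

section Coupling

variable {A B : Type*} [MeasurableSpace A] [MeasurableSpace B]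

theorem inv_measure_univ_smul_smul (ν : Measure A) [IsFiniteMeasure ν] :
    (ν Set.univ)⁻¹ • ν Set.univ • ν = ν := by
  rcases eq_or_ne ν 0 with rfl | h
  · simp
  · rw [smul_smul, ENNReal.inv_mul_cancel (by simpa using h) (measure_ne_top ν _), one_smul]

theorem exists_ge_measurePreserving {α : Measure A} {β : Measure B} [IsFiniteMeasure α]
    [IsFiniteMeasure β] (hαβ : α Set.univ = β Set.univ) {π₀ : Measure (A × B)}
    (hα : π₀.fst ≤ α) (hβ : π₀.snd ≤ β) :
    ∃ π, π₀ ≤ π ∧ MeasurePreserving Prod.fst π α ∧ MeasurePreserving Prod.snd π β := by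
  have : IsFiniteMeasure π₀.fst := isFiniteMeasure_of_le α hα
  have : IsFiniteMeasure π₀.snd := isFiniteMeasure_of_le β hβ
  set α' := α - π₀.fst
  set β' := β - π₀.snd
  have mass : α' Set.univ = β' Set.univ := by
    rw [Measure.sub_apply .univ hα, Measure.sub_apply .univ hβ, hαβ, Measure.fst_univ,
      Measure.snd_univ]
  refine ⟨π₀ + (α' Set.univ)⁻¹ • α'.prod β', Measure.le_add_right le_rfl,
    ⟨measurable_fst, ?_⟩, ⟨measurable_snd, ?_⟩⟩
  · rw [Measure.map_add _ _ measurable_fst, Measure.map_smul, Measure.map_fst_prod, ← mass,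
      inv_measure_univ_smul_smul, add_comm]
    exact Measure.sub_add_cancel_of_le hα
  · rw [Measure.map_add _ _ measurable_snd, Measure.map_smul, Measure.map_snd_prod, mass,
      inv_measure_univ_smul_smul, add_comm]
    exact Measure.sub_add_cancel_of_le hβ

theorem exists_coupling_sum_min_le (α : Measure A) (β : Measure B) [IsProbabilityMeasure α]
    [IsProbabilityMeasure β] {F : Type*} [Fintype F] [MeasurableSpace F]
    [DiscreteMeasurableSpace F] {f : A → F} {k : B → F} (hf : Measurable f) (hk : Measurable k) :
    ∃ π, MeasurePreserving Prod.fst π α ∧ MeasurePreserving Prod.snd π β ∧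
      ∑ s, min (α (f ⁻¹' {s})) (β (k ⁻¹' {s})) ≤ π {p | f p.1 = k p.2} := by
  set w : F → ENNReal := fun s => min (α (f ⁻¹' {s})) (β (k ⁻¹' {s}))
  set π₀ : Measure (A × B) := ∑ s, w s • (α[|f ← s]).prod (β[|k ← s])
  have fst_le : π₀.fst ≤ α := by
    conv_rhs => rw [← sum_meas_smul_cond_fiber hf α]
    rw [Measure.fst, Measure.map_finset_sum' measurable_fst.aemeasurable]
    refine Finset.sum_le_sum fun s _ E => ?_
    rw [Measure.map_smul, Measure.map_fst_prod]
    exact mul_le_mul' (min_le_left _ _) (mul_le_of_le_one_left' prob_le_one)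
  have snd_le : π₀.snd ≤ β := by
    conv_rhs => rw [← sum_meas_smul_cond_fiber hk β]
    rw [Measure.snd, Measure.map_finset_sum' measurable_snd.aemeasurable]
    refine Finset.sum_le_sum fun s _ E => ?_
    rw [Measure.map_smul, Measure.map_snd_prod]
    exact mul_le_mul' (min_le_right _ _) (mul_le_of_le_one_left' prob_le_one)
  obtain ⟨π, hπ, hα, hβ⟩ := exists_ge_measurePreserving (by simp) fst_le snd_le
  refine ⟨π, hα, hβ, le_trans ?_ (hπ _)⟩
  rw [Measure.finsetSum_apply]
  refine Finset.sum_le_sum fun s _ => ?_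
  rcases eq_or_ne (w s) 0 with hs | hs
  · exact hs.trans_le zero_le
  have hfs : α (f ⁻¹' {s}) ≠ 0 := (lt_of_lt_of_le hs.bot_lt (min_le_left _ _)).ne'
  have hks : β (k ⁻¹' {s}) ≠ 0 := (lt_of_lt_of_le hs.bot_lt (min_le_right _ _)).ne'
  calc w s = (w s • (α[|f ← s]).prod (β[|k ← s])) ((f ⁻¹' {s}) ×ˢ (k ⁻¹' {s})) := by
        rw [Measure.smul_apply, Measure.prod_prod, cond_apply_self hfs (measure_ne_top _ _),
          cond_apply_self hks (measure_ne_top _ _), one_mul, smul_eq_mul, mul_one]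
    _ ≤ _ := measure_mono fun p hp => hp.1.trans hp.2.symm

end Coupling

/-! ### Gluing families of plans -/

theorem exists_measurePreserving_prodMk_unitInterval {A B : Type*} [MeasurableSpace A]
    [MeasurableSpace B] [StandardBorelSpace B] [Nonempty B] (τ : Measure (A × B))
    [IsProbabilityMeasure τ] : ∃ r : A × unitInterval → B, Measurable r ∧
      MeasurePreserving (fun p => (p.1, r p)) (τ.fst.prod volume) τ := by
  obtain ⟨r, hr, hrκ⟩ := τ.condKernel.exists_measurable_map_eq_unitInterval
  have hm : Measurable fun p : A × unitInterval => (p.1, Function.uncurry r p) :=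
    measurable_fst.prodMk hr
  refine ⟨Function.uncurry r, hr, hm, ?_⟩
  conv_rhs => rw [← τ.disintegrate τ.condKernel]
  ext s hs
  rw [Measure.map_apply hm hs, Measure.prod_apply (hm hs), Measure.compProd_apply hs]
  refine lintegral_congr fun a => ?_
  rw [← hrκ a, Measure.map_apply hr.of_uncurry_left (measurable_prodMk_left hs)]
  rfl

theorem exists_gluing_family {ι E : Type*} {A B : ι → Type*} [MeasurableSpace E]
    [∀ o, MeasurableSpace (A o)] [∀ o, MeasurableSpace (B o)] [∀ o, StandardBorelSpace (B o)]
    [∀ o, Nonempty (B o)] {α : Measure E} [IsProbabilityMeasure α] {f : ∀ o, E → A o}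
    {τ : ∀ o, Measure (A o × B o)} [∀ o, IsProbabilityMeasure (τ o)]
    (hf : ∀ o, MeasurePreserving (f o) α (τ o).fst) :
    ∃ Γ : Measure (E × ∀ o, B o), MeasurePreserving Prod.fst Γ α ∧
      ∀ o, MeasurePreserving (fun p => (f o p.1, p.2 o)) Γ (τ o) := by
  choose r hr hrτ using fun o => exists_measurePreserving_prodMk_unitInterval (τ o)
  -- The kernels may share one source of randomness, since only pair marginals are prescribed.
  let k : E × unitInterval → E × ∀ o, B o := fun p => (p.1, fun o => r o (f o p.1, p.2))
  have hfr (o) := (hf o).prod (MeasurePreserving.id (volume : Measure unitInterval))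
  have hk : Measurable k :=
    measurable_fst.prodMk (measurable_pi_lambda _ fun o => (hr o).comp (hfr o).measurable)
  refine ⟨(α.prod volume).map k, .map_of_comp measurePreserving_fst measurable_fst hk, fun o => ?_⟩
  exact .map_of_comp ((hrτ o).comp (hfr o)) (by have := (hf o).measurable; fun_prop) hk

/-! ### Gauges as `L²` functions -/

section NearDiagonal

variable {A E : Type*} [MeasurableSpace A] [NormedAddCommGroup E]

theorem eLpNorm_comp_prodMap_sub_le {F : Type*} {G : F × F → E} {C : NNReal}
    (hG : ∀ s t, ‖G s - G t‖ ≤ C) (α : Measure A) [IsProbabilityMeasure α] (a b : A → F)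
    (p : ENNReal) :
    eLpNorm (G ∘ Prod.map a a - G ∘ Prod.map b b) p (α.prod α) ≤
      C * (2 * α {x | a x ≠ b x}) ^ (1 / p.toReal) := by
  set D : Set A := {x | a x ≠ b x}
  set D' : Set (A × A) := D ×ˢ Set.univ ∪ Set.univ ×ˢ D
  have hD' : α.prod α D' ≤ 2 * α D :=
    (measure_union_le _ _).trans_eq (by simp [Measure.prod_prod, two_mul])
  have le_indicator (x : A × A) :
      ‖(G ∘ Prod.map a a - G ∘ Prod.map b b) x‖ ≤ ‖D'.indicator (fun _ => (C : ℝ)) x‖ := by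
    by_cases hx : x ∈ D'
    · simpa [hx] using hG _ _
    · have : a x.1 = b x.1 ∧ a x.2 = b x.2 := by simpa [D', D, not_or] using hx
      simp [Prod.map, this.1, this.2]
  refine (eLpNorm_mono le_indicator).trans ((eLpNorm_indicator_const_le _ _).trans ?_)
  rw [show ‖(C : ℝ)‖ₑ = C by simp [enorm_eq_nnnorm]]
  gcongr

theorem exists_pos_mul_rpow_le (C : NNReal) {r : ℝ} (hr : 0 < r) {ε : ENNReal} (hε : 0 < ε) :
    ∃ δ : ENNReal, 0 < δ ∧ C * δ ^ r ≤ ε := by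
  have cont : Continuous fun δ : ENNReal => C * δ ^ r :=
    (ENNReal.continuous_const_mul ENNReal.coe_ne_top).comp ENNReal.continuous_rpow_const
  have small : ∀ᶠ δ in 𝓝 0, C * δ ^ r ≤ ε :=
    (cont.tendsto' 0 0 (by simp [hr])).eventually_le_const hε
  exact ((eventually_mem_nhdsWithin (s := Set.Ioi 0)).and
    (small.filter_mono nhdsWithin_le_nhds)).exists

theorem eLpNorm_comp_sub_comp_le {B : Type*} [MeasurableSpace B] {α : Measure A} {β : Measure B}
    {u v : A → B} (hu : MeasurePreserving u α β) (hv : MeasurePreserving v α β) {f g : B → E}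
    (hf : AEStronglyMeasurable f β) (hg : AEStronglyMeasurable g β) {p : ENNReal} (hp : 1 ≤ p) :
    eLpNorm (f ∘ u - f ∘ v) p α ≤
      eLpNorm (f - g) p β + eLpNorm (g ∘ u - g ∘ v) p α + eLpNorm (f - g) p β := by
  have approx {w : A → B} (hw : MeasurePreserving w α β) :
      eLpNorm (f ∘ w - g ∘ w) p α = eLpNorm (f - g) p β :=
    eLpNorm_comp_measurePreserving (hf.sub hg) hw
  have meas {w : A → B} (hw : MeasurePreserving w α β) : AEStronglyMeasurable (f ∘ w - g ∘ w) α :=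
    (hf.sub hg).comp_measurePreserving hw
  have meas_g : AEStronglyMeasurable (g ∘ u - g ∘ v) α :=
    (hg.comp_measurePreserving hu).sub (hg.comp_measurePreserving hv)
  calc _ = eLpNorm ((f ∘ u - g ∘ u) + (g ∘ u - g ∘ v) - (f ∘ v - g ∘ v)) p α := by
        congr 1; abel
    _ ≤ eLpNorm (f ∘ u - g ∘ u) p α + eLpNorm (g ∘ u - g ∘ v) p α +
          eLpNorm (f ∘ v - g ∘ v) p α := by
        refine (eLpNorm_sub_le ((meas hu).add meas_g) (meas hv) hp).trans ?_
        gcongr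
        exact eLpNorm_add_le (meas hu) meas_g hp
    _ = _ := by rw [approx hu, approx hv]

theorem exists_partition_eLpNorm_comp_sub_le {X : Type*} [MeasurableSpace X] {ξ : Measure X}
    [IsFiniteMeasure ξ] {p : ENNReal} (hp1 : 1 ≤ p) (hp : p ≠ ⊤) {f : X × X → E}
    (hf : MemLp f p (ξ.prod ξ)) {ε : ENNReal} (hε : ε ≠ 0) :
    ∃ (n : ℕ) (q : X → Fin n) (δ : ENNReal), Measurable q ∧ δ ≠ 0 ∧
      ∀ (α : Measure A) [IsProbabilityMeasure α] {a b : A → X}, MeasurePreserving a α ξ →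
        MeasurePreserving b α ξ → α {x | q (a x) ≠ q (b x)} ≤ δ →
          eLpNorm (f ∘ Prod.map a a - f ∘ Prod.map b b) p (α.prod α) ≤ ε := by
  have hε' : ε / 3 ≠ 0 := ENNReal.div_ne_zero.2 ⟨hε, ENNReal.ofNat_ne_top⟩
  obtain ⟨_, hfg, n, q, G, hq, rfl⟩ := IsStepKernel.exists_eLpNorm_sub_le hp hf hε'
  set g := G ∘ Prod.map q q
  obtain ⟨C, hC⟩ : ∃ C : NNReal, ∀ s t, ‖G s - G t‖ ≤ C :=
    let ⟨C, hC⟩ := Finite.bddAbove_range fun s : (Fin n × Fin n) × (Fin n × Fin n) =>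
      ‖G s.1 - G s.2‖₊
    ⟨C, fun s t => hC ⟨(s, t), rfl⟩⟩
  obtain ⟨δ, δ_pos, hδ⟩ := exists_pos_mul_rpow_le C
    (one_div_pos.2 (ENNReal.toReal_pos (one_pos.trans_le hp1).ne' hp)) (pos_iff_ne_zero.2 hε')
  refine ⟨n, q, δ / 2, hq, (ENNReal.half_pos δ_pos.ne').ne', fun α _ a b ha hb hab => ?_⟩
  have hstep : eLpNorm (g ∘ Prod.map a a - g ∘ Prod.map b b) p (α.prod α) ≤ ε / 3 := by
    refine (eLpNorm_comp_prodMap_sub_le hC α (q ∘ a) (q ∘ b) p).trans (le_trans ?_ hδ)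
    rw [← ENNReal.mul_div_cancel two_ne_zero ENNReal.ofNat_ne_top (a := 2) (b := δ)]
    gcongr
    exact hab
  have g_meas : StronglyMeasurable g := IsStepKernel.stronglyMeasurable ⟨n, q, G, hq, rfl⟩
  calc _ ≤ ε / 3 + ε / 3 + ε / 3 := by
        refine (eLpNorm_comp_sub_comp_le (ha.prod ha) (hb.prod hb) hf.1
          g_meas.aestronglyMeasurable hp1).trans ?_
        gcongr
    _ = ε := ENNReal.add_thirds ε

end NearDiagonal

namespace GMSpace

variable {A A' : Type*} [MeasurableSpace A] [MeasurableSpace A'] {α : Measure A} {α' : Measure A'}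

/-- The gauge of `X`, seen through a measure preserving map into `X`, as an element of `L²`. For
maps `a` into `X` and `b` into `Y` on one probability space, the distance of these elements is the
`gw` cost of the plan `α.map fun e => (a e, b e)`. -/
noncomputable def gaugeLp (X : GMSpace.{u}) [SFinite α] {a : A → X.carrier}
    (ha : MeasurePreserving a α X.ξ) : Lp ℝ 2 (α.prod α) :=
  (X.memLp_pullback ha.measurable ha.map_eq).toLp _

variable {X Y : GMSpace.{u}} {a : A → X.carrier} {b : A → Y.carrier}

theorem coeFn_gaugeLp [SFinite α] (ha : MeasurePreserving a α X.ξ) :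
    X.gaugeLp ha =ᵐ[α.prod α] fun p => X.g (a p.1) (a p.2) :=
  MemLp.coeFn_toLp _

theorem edist_gaugeLp [SFinite α] (ha : MeasurePreserving a α X.ξ)
    (hb : MeasurePreserving b α Y.ξ) :
    edist (X.gaugeLp ha) (Y.gaugeLp hb) =
      eLpNorm (fun p : A × A => X.g (a p.1) (a p.2) - Y.g (b p.1) (b p.2)) 2 (α.prod α) :=
  Lp.edist_toLp_toLp _ _ _ _

theorem map_prodMk_mem_plans [IsProbabilityMeasure α] (ha : MeasurePreserving a α X.ξ)
    (hb : MeasurePreserving b α Y.ξ) : α.map (fun e => (a e, b e)) ∈ plans X Y :=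
  (gwFun_map X Y ha.measurable hb.measurable ha.map_eq hb.map_eq).1

theorem gwFun_map_prodMk [IsProbabilityMeasure α] (ha : MeasurePreserving a α X.ξ)
    (hb : MeasurePreserving b α Y.ξ) :
    gwFun X Y (α.map fun e => (a e, b e)) = dist (X.gaugeLp ha) (Y.gaugeLp hb) := by
  rw [(gwFun_map X Y ha.measurable hb.measurable ha.map_eq hb.map_eq).2, ← edist_gaugeLp ha hb,
    dist_edist]

theorem gw_le_dist_gaugeLp [IsProbabilityMeasure α] (ha : MeasurePreserving a α X.ξ)
    (hb : MeasurePreserving b α Y.ξ) : gw X Y ≤ dist (X.gaugeLp ha) (Y.gaugeLp hb) :=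
  (gw_le X Y (map_prodMk_mem_plans ha hb)).trans_eq (gwFun_map_prodMk ha hb)

theorem dist_gaugeLp_comp [SFinite α] [SFinite α'] (ha : MeasurePreserving a α X.ξ)
    (hb : MeasurePreserving b α Y.ξ) {φ : A' → A} (hφ : MeasurePreserving φ α' α) :
    dist (X.gaugeLp (ha.comp hφ)) (Y.gaugeLp (hb.comp hφ)) = dist (X.gaugeLp ha) (Y.gaugeLp hb) :=
  (Lp.isometry_compMeasurePreserving (hφ.prod hφ)).dist_eq (X.gaugeLp ha) (Y.gaugeLp hb)

theorem exists_partition_dist_gaugeLp_le (A : Type*) [MeasurableSpace A] (X : GMSpace.{u}) {ε : ℝ}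
    (hε : 0 < ε) :
    ∃ (n : ℕ) (q : X.carrier → Fin n) (δ : ENNReal), Measurable q ∧ δ ≠ 0 ∧
      ∀ (α : Measure A) [IsProbabilityMeasure α] {a b : A → X.carrier}
        (ha : MeasurePreserving a α X.ξ) (hb : MeasurePreserving b α X.ξ),
        α {x | q (a x) ≠ q (b x)} ≤ δ → dist (X.gaugeLp ha) (X.gaugeLp hb) ≤ ε := by
  obtain ⟨n, q, δ, hq, hδ, h⟩ := exists_partition_eLpNorm_comp_sub_le (A := A) one_le_two
    ENNReal.ofNat_ne_top X.memLp (ENNReal.ofReal_pos.2 hε).ne'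
  refine ⟨n, q, δ, hq, hδ, fun α _ a b ha hb hab => ?_⟩
  rw [← edist_le_ofReal hε.le, edist_gaugeLp]
  exact h α ha hb hab

theorem gaugeLp_meanSpace [SFinite α] {N : ℕ} {Z : Fin N → GMSpace.{u}} (ρ : Fin N → ℝ)
    {μ : Measure (∀ i, (Z i).carrier)} (hμ : μ ∈ multiPlans Z) {z : ∀ i, A → (Z i).carrier}
    (hz : ∀ i, MeasurePreserving (z i) α (Z i).ξ)
    (hm : MeasurePreserving (fun e i => z i e) α μ) :
    (meanSpace Z ρ μ hμ).gaugeLp hm = ∑ i, ρ i • (Z i).gaugeLp (hz i) := by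
  refine Lp.ext ?_
  have coe_smul : ∀ᵐ p ∂α.prod α, ∀ i, (ρ i • (Z i).gaugeLp (hz i)) p =
      ρ i * (Z i).g (z i p.1) (z i p.2) := ae_all_iff.2 fun i => by
    filter_upwards [Lp.coeFn_smul (ρ i) ((Z i).gaugeLp (hz i)), coeFn_gaugeLp (hz i)] with p h h'
    rw [h, Pi.smul_apply, smul_eq_mul, h']
  filter_upwards [Lp.coeFn_fun_finsetSum Finset.univ fun i => ρ i • (Z i).gaugeLp (hz i),
    coe_smul, coeFn_gaugeLp (X := meanSpace Z ρ μ hμ) hm] with p h h' h''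
  simp only [h'', h, h']
  rfl

end GMSpace

/-! ### Plans with prescribed marginals -/

theorem isProbabilityMeasure_of_measurePreserving {A B : Type*} [MeasurableSpace A]
    [MeasurableSpace B] {α : Measure A} {β : Measure B} [IsProbabilityMeasure β] {f : A → B}
    (hf : MeasurePreserving f α β) : IsProbabilityMeasure α :=
  have : IsProbabilityMeasure (α.map f) := by rwa [hf.map_eq]
  Measure.isProbabilityMeasure_of_map f

section JointPlans

variable {ι : Type*} {A : ι → Type*} [∀ o, MeasurableSpace (A o)] {ξ : ∀ o, Measure (A o)}

/-- The multi-marginal transport plans between the members of a family of measures. -/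
def jointPlans (ξ : ∀ o, Measure (A o)) : Set (ProbabilityMeasure (∀ o, A o)) :=
  {Γ | ∀ o, MeasurePreserving (Function.eval o) (Γ : Measure (∀ o, A o)) (ξ o)}

theorem measure_univ_pi_diff_le [Countable ι] {Γ : Measure (∀ o, A o)}
    (hΓ : ∀ o, MeasurePreserving (Function.eval o) Γ (ξ o)) (s t : ∀ o, Set (A o)) :
    Γ (Set.univ.pi t \ Set.univ.pi s) ≤ ∑' o, ξ o (t o \ s o) := by
  have hsub : Set.univ.pi t \ Set.univ.pi s ⊆ ⋃ o, Function.eval o ⁻¹' (t o \ s o) := by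
    rintro x ⟨hxt, hxs⟩
    obtain ⟨o, ho⟩ : ∃ o, x o ∉ s o := by simpa using hxs
    exact Set.mem_iUnion.2 ⟨o, hxt o trivial, ho⟩
  exact (measure_mono hsub).trans <| (measure_iUnion_le _).trans <|
    ENNReal.tsum_le_tsum fun o => (hΓ o).measure_preimage_le _

theorem nonempty_jointPlans [Finite ι] [∀ o, IsProbabilityMeasure (ξ o)] :
    (jointPlans ξ).Nonempty :=
  have := Fintype.ofFinite ι
  ⟨⟨Measure.pi ξ, inferInstance⟩, measurePreserving_eval ξ⟩

variable [∀ o, TopologicalSpace (A o)] [∀ o, PolishSpace (A o)] [∀ o, BorelSpace (A o)]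
  [∀ o, IsProbabilityMeasure (ξ o)]

variable (ξ) in
theorem isTightMeasureSet_jointPlans [Countable ι] :
    IsTightMeasureSet {μ : Measure (∀ o, A o) | ∃ Γ ∈ jointPlans ξ, Γ = μ} := by
  rw [isTightMeasureSet_iff_exists_isCompact_measure_compl_le]
  intro ε hε
  obtain ⟨δ, hδ, hδε⟩ := ENNReal.exists_pos_sum_of_countable' hε.ne' ι
  choose K hK hKδ using fun o => isTightMeasureSet_iff_exists_isCompact_measure_compl_le.1
    (isTightMeasureSet_singleton (μ := ξ o)) (δ o) (hδ o)
  refine ⟨Set.univ.pi K, isCompact_univ_pi hK, ?_⟩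
  rintro _ ⟨Γ, hΓ, rfl⟩
  calc (Γ : Measure (∀ o, A o)) (Set.univ.pi K)ᶜ ≤ ∑' o, ξ o (K o)ᶜ := by
        simpa only [Set.pi_univ, Set.compl_eq_univ_sdiff] using
          measure_univ_pi_diff_le hΓ K fun _ => Set.univ
    _ ≤ ∑' o, δ o := ENNReal.tsum_le_tsum fun o => hKδ o _ rfl
    _ ≤ ε := hδε.le

theorem isClosed_jointPlans [Countable ι] : IsClosed (jointPlans ξ) := by
  have heval := fun o => continuous_apply (A := A) o
  let ξ' : ∀ o, ProbabilityMeasure (A o) := fun o => ⟨ξ o, inferInstance⟩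
  have : jointPlans ξ = ⋂ o, {Γ | Γ.map (heval o).measurable.aemeasurable = ξ' o} := by
    ext Γ
    refine Iff.trans (forall_congr' fun o => ?_) Set.mem_iInter.symm
    exact ⟨fun h => Subtype.ext h.map_eq,
      fun h => ⟨(heval o).measurable, congrArg ProbabilityMeasure.toMeasure h⟩⟩
  rw [this]
  exact isClosed_iInter fun o =>
    isClosed_eq (ProbabilityMeasure.continuous_map (heval o)) continuous_const

instance compactSpace_jointPlans [Countable ι] : CompactSpace (jointPlans ξ) := by
  rw [← isCompact_iff_compactSpace, ← isClosed_jointPlans.closure_eq]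
  exact isCompact_closure_of_isTightMeasureSet (isTightMeasureSet_jointPlans ξ)

variable [Finite ι]

-- The set is merely measurable: the fixed marginals make up for the missing openness.
theorem lowerSemicontinuous_measure_univ_pi {s : ∀ o, Set (A o)} (hs : ∀ o, MeasurableSet (s o)) :
    LowerSemicontinuous fun Γ : jointPlans ξ => (Γ.1 : Measure (∀ o, A o)) (Set.univ.pi s) := by
  intro Γ y hy
  obtain ⟨r, hr, hyr⟩ := ENNReal.lt_iff_exists_add_pos_lt.1 hy
  obtain ⟨η, hη, hηr⟩ := ENNReal.exists_pos_sum_of_countable' (ENNReal.coe_ne_zero.2 hr.ne') ι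
  choose U hsU hU _ hUη using fun o =>
    (hs o).exists_isOpen_sdiff_lt (measure_ne_top (ξ o) _) (hη o).ne'
  have hUo : IsOpen (Set.univ.pi U) := isOpen_set_pi Set.finite_univ fun o _ => hU o
  have hyU : y + r < (Γ.1 : Measure (∀ o, A o)) (Set.univ.pi U) :=
    hyr.trans_le (measure_mono (Set.pi_mono fun o _ => hsU o))
  filter_upwards [eventually_lt_of_lt_liminf (hyU.trans_le
    (ProbabilityMeasure.le_liminf_measure_open_of_tendsto (continuous_subtype_val.tendsto Γ) hUo))]
    with Γ' hΓ'
  refine lt_of_add_lt_add_right (hΓ'.trans_le ?_)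
  have hpi := measure_univ_pi_diff_le Γ'.2 s U
  calc (Γ'.1 : Measure (∀ o, A o)) (Set.univ.pi U)
      ≤ (Γ'.1 : Measure (∀ o, A o)) (Set.univ.pi s) +
          (Γ'.1 : Measure (∀ o, A o)) (Set.univ.pi U \ Set.univ.pi s) :=
        (measure_sdiff_le_iff_le_add (MeasurableSet.univ_pi hs).nullMeasurableSet
          (Set.pi_mono fun o _ => hsU o) (measure_ne_top _ _)).1 le_rfl
    _ ≤ (Γ'.1 : Measure (∀ o, A o)) (Set.univ.pi s) + r := by
        gcongr
        exact (hpi.trans (ENNReal.tsum_le_tsum fun o => (hUη o).le)).trans hηr.le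

theorem eventually_exists_coupling_measure_ne_le {F : ι → Type*} [∀ o, Finite (F o)]
    [∀ o, MeasurableSpace (F o)] [∀ o, DiscreteMeasurableSpace (F o)] {q : ∀ o, A o → F o}
    (hq : ∀ o, Measurable (q o)) (Γ : jointPlans ξ) {δ : ENNReal} (hδ : δ ≠ 0) :
    ∀ᶠ Γ' in 𝓝 Γ, ∃ π : Measure ((∀ o, A o) × ∀ o, A o),
      MeasurePreserving Prod.fst π Γ'.1 ∧ MeasurePreserving Prod.snd π Γ.1 ∧
        ∀ o, π {p | q o (p.1 o) ≠ q o (p.2 o)} ≤ δ := by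
  classical
  have := Fintype.ofFinite (∀ o, F o)
  set Q : (∀ o, A o) → ∀ o, F o := fun x o => q o (x o)
  have hQ : Measurable Q := by fun_prop
  have hpre : ∀ s, Q ⁻¹' {s} = Set.univ.pi fun o => q o ⁻¹' {s o} := fun s => by
    ext x
    simp [Q, funext_iff]
  set overlap : jointPlans ξ → ENNReal := fun Γ' =>
    ∑ s, min ((Γ'.1 : Measure (∀ o, A o)) (Q ⁻¹' {s})) ((Γ.1 : Measure (∀ o, A o)) (Q ⁻¹' {s}))
  have hoverlap : LowerSemicontinuous overlap := lowerSemicontinuous_sum fun s _ => by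
    simp only [hpre]
    exact (lowerSemicontinuous_measure_univ_pi fun o => hq o (.singleton _)).inf
      lowerSemicontinuous_const
  have hΓ : overlap Γ = 1 := by
    simp only [overlap, min_self]
    rw [sum_measure_preimage_singleton _ fun s _ => hQ (.singleton s)]
    simp
  have hlt : 1 - δ < overlap Γ := by
    rw [hΓ]
    exact ENNReal.sub_lt_self ENNReal.one_ne_top one_ne_zero hδ
  filter_upwards [hoverlap Γ _ hlt] with Γ' hΓ'
  obtain ⟨π, hπ₁, hπ₂, hπ⟩ := exists_coupling_sum_min_le (Γ'.1 : Measure (∀ o, A o)) Γ.1 hQ hQ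
  refine ⟨π, hπ₁, hπ₂, fun o => ?_⟩
  have := isProbabilityMeasure_of_measurePreserving hπ₁
  have hne : MeasurableSet {p : (∀ o, A o) × ∀ o, A o | Q p.1 = Q p.2} :=
    measurableSet_eq_fun (hQ.comp measurable_fst) (hQ.comp measurable_snd)
  calc π {p | q o (p.1 o) ≠ q o (p.2 o)} ≤ π {p | Q p.1 = Q p.2}ᶜ :=
        measure_mono fun p hp h => hp (congrFun h o)
    _ = 1 - π {p | Q p.1 = Q p.2} := prob_compl_eq_one_sub hne
    _ ≤ 1 - (1 - δ) := tsub_le_tsub_left (hΓ'.le.trans hπ) 1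
    _ ≤ δ := tsub_tsub_le

end JointPlans

namespace GMSpace

variable {ι : Type*} {Z Z' : ι → GMSpace.{u}}

/-- The plans between all members of a family of gm-spaces. -/
abbrev JointPlan (Z : ι → GMSpace.{u}) : Type _ :=
  jointPlans fun o => (Z o).ξ

namespace JointPlan

variable {E : Type*} [MeasurableSpace E] {α : Measure E} [IsProbabilityMeasure α]
  {z : ∀ o, E → (Z o).carrier}

/-- The joint law of a family of measure preserving maps defined on one probability space. -/
noncomputable def ofMaps (hz : ∀ o, MeasurePreserving (z o) α (Z o).ξ) : JointPlan Z :=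
  have hmeas : Measurable fun e o => z o e := measurable_pi_iff.2 fun o => (hz o).measurable
  ⟨⟨α.map fun e o => z o e, Measure.isProbabilityMeasure_map hmeas.aemeasurable⟩,
    fun o => .map_of_comp (hz o) (measurable_pi_apply o) hmeas⟩

theorem measurePreserving_ofMaps (hz : ∀ o, MeasurePreserving (z o) α (Z o).ξ) :
    MeasurePreserving (fun e o => z o e) α (ofMaps hz).1 :=
  (measurable_pi_iff.2 fun o => (hz o).measurable).measurePreserving α

/-- The gauge of the `o`-th space as a function on the square of the product space. -/
noncomputable def gauge (Γ : JointPlan Z) (o : ι) :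
    Lp ℝ 2 ((Γ.1 : Measure (∀ o, (Z o).carrier)).prod (Γ.1 : Measure (∀ o, (Z o).carrier))) :=
  (Z o).gaugeLp (Γ.2 o)

/-- The cost of the plan between the spaces `o` and `o'` that is induced by a joint plan. -/
noncomputable def pairDist (Γ : JointPlan Z) (o o' : ι) : ℝ :=
  dist (Γ.gauge o) (Γ.gauge o')

theorem pairDist_ofMaps (hz : ∀ o, MeasurePreserving (z o) α (Z o).ξ) (o o' : ι) :
    (ofMaps hz).pairDist o o' = dist ((Z o).gaugeLp (hz o)) ((Z o').gaugeLp (hz o')) :=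
  (dist_gaugeLp_comp _ _ (measurePreserving_ofMaps hz)).symm

theorem gw_le_pairDist (Γ : JointPlan Z) (o o' : ι) : gw (Z o) (Z o') ≤ Γ.pairDist o o' :=
  gw_le_dist_gaugeLp _ _

/-- Two joint plans can be coupled in such a way that the gauges of the spaces with index `o` have
`L²` distance at most `c o`. -/
def GaugeClose (c : ι → ℝ) (Γ : JointPlan Z) (Γ' : JointPlan Z') : Prop :=
  ∃ (π : Measure ((∀ o, (Z o).carrier) × ∀ o, (Z' o).carrier)) (_ : IsProbabilityMeasure π)
    (h : MeasurePreserving Prod.fst π Γ.1) (h' : MeasurePreserving Prod.snd π Γ'.1),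
    ∀ o, dist ((Z o).gaugeLp ((Γ.2 o).comp h)) ((Z' o).gaugeLp ((Γ'.2 o).comp h')) ≤ c o

theorem GaugeClose.dist_pairDist_le {c : ι → ℝ} {Γ : JointPlan Z} {Γ' : JointPlan Z'}
    (h : GaugeClose c Γ Γ') (o o' : ι) :
    dist (Γ.pairDist o o') (Γ'.pairDist o o') ≤ c o + c o' := by
  obtain ⟨π, hπ, h₁, h₂, hc⟩ := h
  rw [pairDist, pairDist, gauge, gauge, gauge, gauge, ← dist_gaugeLp_comp _ _ h₁,
    ← dist_gaugeLp_comp _ _ h₂]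
  exact (dist_dist_dist_le _ _ _ _).trans (add_le_add (hc o) (hc o'))

variable [Finite ι]

theorem eventually_gaugeClose (Γ : JointPlan Z) {ε : ℝ} (hε : 0 < ε) :
    ∀ᶠ Γ' in 𝓝 Γ, GaugeClose (fun _ => ε) Γ' Γ := by
  have := Fintype.ofFinite ι
  choose n q δ hq hδ hclose using fun o => exists_partition_dist_gaugeLp_le
    ((∀ o, (Z o).carrier) × ∀ o, (Z o).carrier) (Z o) hε
  have hδinf : Finset.univ.inf δ ≠ 0 :=
    ((Finset.lt_inf_iff ENNReal.zero_lt_top).2 fun o _ => pos_iff_ne_zero.2 (hδ o)).ne'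
  filter_upwards [eventually_exists_coupling_measure_ne_le hq Γ hδinf] with Γ' hΓ'
  obtain ⟨π, h₁, h₂, hπ⟩ := hΓ'
  have hprob := isProbabilityMeasure_of_measurePreserving h₁
  exact ⟨π, hprob, h₁, h₂, fun o =>
    hclose o π _ _ ((hπ o).trans (Finset.inf_le (Finset.mem_univ o)))⟩

theorem continuous_pairDist (o o' : ι) : Continuous fun Γ : JointPlan Z => Γ.pairDist o o' := by
  refine Metric.continuous_iff'.2 fun Γ ε hε => ?_
  filter_upwards [Γ.eventually_gaugeClose (show 0 < ε / 3 by positivity)] with Γ' hΓ'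
  exact (hΓ'.dist_pairDist_le o o').trans_lt (by linarith)

end JointPlan

open JointPlan

theorem nonempty_optPlans (X Y : GMSpace.{u}) : (optPlans X Y).Nonempty := by
  let Z : Bool → GMSpace.{u} := fun b => cond b X Y
  have : Nonempty (JointPlan Z) := nonempty_jointPlans.to_subtype
  obtain ⟨Γ, -, hΓ⟩ := isCompact_univ.exists_isMinOn Set.univ_nonempty
    (continuous_pairDist (Z := Z) true false).continuousOn
  refine ⟨_, map_prodMk_mem_plans (Γ.2 true) (Γ.2 false), ?_⟩
  refine le_antisymm ?_ (gw_le _ _ (map_prodMk_mem_plans (Γ.2 true) (Γ.2 false)))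
  refine le_csInf (nonempty_gwFun X Y) ?_
  rintro _ ⟨π, ⟨hπ, hX, hY⟩, rfl⟩
  have hz : ∀ b, MeasurePreserving
      (Bool.rec Prod.snd Prod.fst b : X.carrier × Y.carrier → (Z b).carrier) π (Z b).ξ := by
    rintro (_ | _)
    exacts [⟨measurable_snd, hY⟩, ⟨measurable_fst, hX⟩]
  calc _ = Γ.pairDist true false := gwFun_map_prodMk (Γ.2 true) (Γ.2 false)
    _ ≤ (ofMaps hz).pairDist true false := hΓ (Set.mem_univ _)
    _ = gwFun X Y π := by
      rw [pairDist_ofMaps, ← gwFun_map_prodMk]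
      exact congrArg (gwFun X Y) Measure.map_id

theorem JointPlan.exists_gaugeClose_gw (Γ : JointPlan Z) (Z' : ι → GMSpace.{u}) :
    ∃ Γ' : JointPlan Z', GaugeClose (fun o => gw (Z o) (Z' o)) Γ Γ' := by
  choose τ hτ using fun o => nonempty_optPlans (Z o) (Z' o)
  have hprob : ∀ o, IsProbabilityMeasure (τ o) := fun o => (hτ o).1.1
  have hne : ∀ o, Nonempty (Z' o).carrier := fun o => nonempty_of_isProbabilityMeasure (Z' o).ξ
  obtain ⟨π, h₁, hπτ⟩ := exists_gluing_family (τ := τ) fun o => by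
    rw [Measure.fst, (hτ o).1.2.1]
    exact Γ.2 o
  have hπ := isProbabilityMeasure_of_measurePreserving h₁
  have hsnd : ∀ o, MeasurePreserving (fun p => p.2 o) π (Z' o).ξ := fun o =>
    (MeasurePreserving.mk measurable_snd (hτ o).1.2.2).comp (hπτ o)
  refine ⟨ofMaps hsnd, π, hπ, h₁, measurePreserving_ofMaps hsnd, fun o => ?_⟩
  refine ((gwFun_map_prodMk _ _).symm.trans ?_).le
  exact (congrArg _ (hπτ o).map_eq).trans (hτ o).2

end GMSpace

/-! ### The relaxed tangential barycenter map -/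

theorem nonempty_of_mem_stdSimplex {ι : Type*} [Fintype ι] {w : ι → ℝ} (hw : w ∈ stdSimplex ℝ ι) :
    Nonempty ι := by
  by_contra! h
  simpa using hw.2

theorem sq_norm_sub_sum_smul_add_sum {ι E : Type*} [Fintype ι] [NormedAddCommGroup E]
    [InnerProductSpace ℝ E] {w : ι → ℝ} (hw : ∑ i, w i = 1) (x : ι → E) (y : E) :
    ‖y - ∑ i, w i • x i‖ ^ 2 + ∑ i, w i * ‖∑ j, w j • x j - x i‖ ^ 2 =
      ∑ i, w i * ‖y - x i‖ ^ 2 := by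
  set m := ∑ i, w i • x i
  have hcross : ∑ i, w i * inner ℝ (y - m) (m - x i) = 0 := by
    simp only [← real_inner_smul_right, ← inner_sum, smul_sub, Finset.sum_sub_distrib,
      ← Finset.sum_smul, hw, one_smul]
    rw [sub_self, inner_zero_right]
  have hexpand : ∀ i, w i * ‖y - x i‖ ^ 2 = w i * ‖y - m‖ ^ 2 +
      (2 * (w i * inner ℝ (y - m) (m - x i)) + w i * ‖m - x i‖ ^ 2) := fun i => by
    rw [← sub_add_sub_cancel y m (x i), norm_add_sq_real]
    ring
  simp only [hexpand, Finset.sum_add_distrib, ← Finset.mul_sum, ← Finset.sum_mul, hcross, hw]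
  ring

namespace GMSpace

variable {N : ℕ}

namespace JointPlan

variable {Z Z' : Option (Fin N) → GMSpace.{u}}

/-- The mean space of the spaces with index `some i`, coupled by a joint plan that also involves a
reference space with index `none`. -/
noncomputable def mean (ρ : Fin N → ℝ) (Γ : JointPlan Z) : GMSpace.{u} :=
  meanSpace (fun i => Z (some i)) ρ (ofMaps fun i => Γ.2 (some i)).1
    ⟨inferInstance, fun i => ((ofMaps fun i => Γ.2 (some i)).2 i).map_eq⟩

theorem measurePreserving_mean (ρ : Fin N → ℝ) (Γ : JointPlan Z) :
    MeasurePreserving (β := (Γ.mean ρ).carrier) (fun (x : ∀ o, (Z o).carrier) i => x (some i)) Γ.1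
      (Γ.mean ρ).ξ :=
  measurePreserving_ofMaps fun i => Γ.2 (some i)

theorem gaugeLp_mean (ρ : Fin N → ℝ) (Γ : JointPlan Z) {A : Type*} [MeasurableSpace A]
    {α : Measure A} [SFinite α] {φ : A → ∀ o, (Z o).carrier} (hφ : MeasurePreserving φ α Γ.1) :
    (Γ.mean ρ).gaugeLp ((Γ.measurePreserving_mean ρ).comp hφ) =
      ∑ i, ρ i • (Z (some i)).gaugeLp ((Γ.2 (some i)).comp hφ) :=
  gaugeLp_meanSpace ρ _ (fun i => (Γ.2 (some i)).comp hφ) _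

theorem gw_mean_le_dist (ρ : Fin N → ℝ) (Γ : JointPlan Z) (o : Option (Fin N)) :
    gw (Z o) (Γ.mean ρ) ≤ dist (Γ.gauge o) (∑ i, ρ i • Γ.gauge (some i)) :=
  (gw_le_dist_gaugeLp (Γ.2 o) (Γ.measurePreserving_mean ρ)).trans_eq <|
    congrArg (dist (Γ.gauge o)) (Γ.gaugeLp_mean ρ (.id _))

theorem GaugeClose.gw_mean_le {ρ : Fin N → ℝ} (hρ : ∀ i, 0 ≤ ρ i) {c : Option (Fin N) → ℝ}
    {Γ : JointPlan Z} {Γ' : JointPlan Z'} (h : GaugeClose c Γ Γ') :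
    gw (Γ.mean ρ) (Γ'.mean ρ) ≤ ∑ i, ρ i * c (some i) := by
  obtain ⟨π, hπ, h₁, h₂, hc⟩ := h
  refine (gw_le_dist_gaugeLp ((Γ.measurePreserving_mean ρ).comp h₁)
    ((Γ'.measurePreserving_mean ρ).comp h₂)).trans ?_
  rw [Γ.gaugeLp_mean ρ h₁, Γ'.gaugeLp_mean ρ h₂]
  refine dist_sum_sum_le_of_le _ fun i _ => ?_
  rw [dist_smul₀, Real.norm_of_nonneg (hρ i)]
  exact mul_le_mul_of_nonneg_left (hc (some i)) (hρ i)

theorem continuous_toGM_mean {ρ : Fin N → ℝ} (hρ : ρ ∈ stdSimplex ℝ (Fin N)) :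
    Continuous fun Γ : JointPlan Z => (Γ.mean ρ).toGM := by
  refine Metric.continuous_iff'.2 fun Γ ε hε => ?_
  filter_upwards [Γ.eventually_gaugeClose (half_pos hε)] with Γ' hΓ'
  calc dist (Γ'.mean ρ).toGM (Γ.mean ρ).toGM ≤ ∑ i, ρ i * (ε / 2) := hΓ'.gw_mean_le hρ.1
    _ = ε / 2 := by rw [← Finset.sum_mul, hρ.2, one_mul]
    _ < ε := half_lt_self hε

end JointPlan

open JointPlan

variable {ρ : Fin N → ℝ} {𝔛 : Fin N → GM.{u}}

theorem toGM_mean_mem_relaxedTB {Z : Option (Fin N) → GMSpace.{u}} {Γ : JointPlan Z}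
    (hΓ : ∀ i, Γ.pairDist none (some i) = gw (Z none) (Z (some i))) :
    (Γ.mean ρ).toGM ∈ relaxedTB ρ (fun i => (Z (some i)).toGM) (Z none).toGM := by
  have hm := (Γ.measurePreserving_mean ρ).measurable
  have hpair : Measurable fun x : ∀ o, (Z o).carrier => (x none, fun i => x (some i)) :=
    (measurable_pi_apply none).prodMk hm
  have hplan (i : Fin N) : (Γ.1 : Measure (∀ o, (Z o).carrier)).map (fun x => (x none, x (some i)))
      ∈ plans (Z none) (Z (some i)) :=
    map_prodMk_mem_plans (Γ.2 none) (Γ.2 (some i))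
  refine ⟨fun i => Z (some i), Z none, fun _ => rfl, rfl, (Γ.mean ρ).ξ,
    ⟨fun i => (Γ.1 : Measure (∀ o, (Z o).carrier)).map fun x => (x none, x (some i)),
      fun i => ⟨hplan i, ?_⟩,
      (Γ.1 : Measure (∀ o, (Z o).carrier)).map fun x => (x none, fun i => x (some i)),
      ⟨Measure.isProbabilityMeasure_map hpair.aemeasurable, fun i => ?_⟩, ?_⟩, rfl⟩
  · exact (gwFun_map_prodMk (Γ.2 none) (Γ.2 (some i))).trans (hΓ i)
  · exact Measure.map_map (by fun_prop) hpair
  · exact Measure.map_map measurable_snd hpair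

theorem exists_jointPlan_of_mem_relaxedTB [Nonempty (Fin N)] {𝔜 ℨ : GM.{u}}
    (h : ℨ ∈ relaxedTB ρ 𝔛 𝔜) :
    ∃ (Z : Option (Fin N) → GMSpace.{u}) (Γ : JointPlan Z), (Z none).toGM = 𝔜 ∧
      (∀ i, (Z (some i)).toGM = 𝔛 i) ∧
      (∀ i, Γ.pairDist none (some i) = gw (Z none) (Z (some i))) ∧ (Γ.mean ρ).toGM = ℨ := by
  obtain ⟨X, Y, hX, hY, μ, hμ, rfl⟩ := h
  obtain ⟨π, hπ, γ, ⟨hγ, hγπ⟩, rfl⟩ := id hμ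
  have hpair : ∀ i, MeasurePreserving (fun p => (p.1, p.2 i)) γ (π i) := fun i =>
    ⟨by fun_prop, hγπ i⟩
  have hfst : MeasurePreserving Prod.fst γ Y.ξ :=
    let i := Classical.arbitrary (Fin N)
    (MeasurePreserving.mk measurable_fst (hπ i).1.2.1).comp (hpair i)
  have hsnd : ∀ i, MeasurePreserving (fun p => p.2 i) γ (X i).ξ := fun i =>
    (MeasurePreserving.mk measurable_snd (hπ i).1.2.2).comp (hpair i)
  let Z : Option (Fin N) → GMSpace.{u} := fun o => o.elim Y X
  let z : ∀ o, Y.carrier × (∀ i, (X i).carrier) → (Z o).carrier := fun o p =>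
    match o with
    | none => p.1
    | some i => p.2 i
  have hz : ∀ o, MeasurePreserving (z o) γ (Z o).ξ := by
    rintro (_ | i)
    exacts [hfst, hsnd i]
  refine ⟨Z, ofMaps hz, hY, hX, fun i => ?_, ?_⟩
  · refine (pairDist_ofMaps hz _ _).trans <| (gwFun_map_prodMk hfst (hsnd i)).symm.trans ?_
    exact (congrArg (gwFun Y (X i)) (hγπ i)).trans (hπ i).2
  · have hmean : γ.map Prod.snd = ((ofMaps hz).mean ρ).ξ :=
      (((ofMaps hz).measurePreserving_mean ρ).comp (measurePreserving_ofMaps hz)).map_eq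
    simp only [hmean]
    rfl

theorem sq_dist_add_le_of_mem_relaxedTB (hρ : ρ ∈ stdSimplex ℝ (Fin N)) {𝔜 ℨ : GM.{u}}
    (h : ℨ ∈ relaxedTB ρ 𝔛 𝔜) :
    dist 𝔜 ℨ ^ 2 + ∑ i, ρ i * dist ℨ (𝔛 i) ^ 2 ≤ ∑ i, ρ i * dist 𝔜 (𝔛 i) ^ 2 := by
  have := nonempty_of_mem_stdSimplex hρ
  obtain ⟨Z, Γ, rfl, hX, hΓ, rfl⟩ := exists_jointPlan_of_mem_relaxedTB h
  set m := ∑ i, ρ i • Γ.gauge (some i)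
  have hY : dist (Z none).toGM (Γ.mean ρ).toGM ≤ ‖Γ.gauge none - m‖ :=
    (Γ.gw_mean_le_dist ρ none).trans_eq (dist_eq_norm _ _)
  have hm : ∀ i, dist (Γ.mean ρ).toGM (𝔛 i) ≤ ‖m - Γ.gauge (some i)‖ := fun i => by
    rw [← hX i, dist_comm, ← dist_eq_norm, dist_comm m]
    exact Γ.gw_mean_le_dist ρ (some i)
  calc dist (Z none).toGM (Γ.mean ρ).toGM ^ 2 + ∑ i, ρ i * dist (Γ.mean ρ).toGM (𝔛 i) ^ 2
      ≤ ‖Γ.gauge none - m‖ ^ 2 + ∑ i, ρ i * ‖m - Γ.gauge (some i)‖ ^ 2 := by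
        gcongr with i
        · exact hρ.1 i
        · exact hm i
    _ = ∑ i, ρ i * ‖Γ.gauge none - Γ.gauge (some i)‖ ^ 2 :=
        sq_norm_sub_sum_smul_add_sum hρ.2 _ _
    _ = ∑ i, ρ i * dist (Z none).toGM (𝔛 i) ^ 2 := by
        simp only [← hX, dist_toGM, ← hΓ, pairDist, dist_eq_norm]

theorem tendsto_dist_succ_of_mem_relaxedTB (hρ : ρ ∈ stdSimplex ℝ (Fin N)) {𝔜 : ℕ → GM.{u}}
    (h : ∀ n, 𝔜 (n + 1) ∈ relaxedTB ρ 𝔛 (𝔜 n)) :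
    Tendsto (fun n => dist (𝔜 n) (𝔜 (n + 1))) atTop (𝓝 0) := by
  set B : ℕ → ℝ := fun n => ∑ i, ρ i * dist (𝔜 n) (𝔛 i) ^ 2
  have hB : ∀ n, dist (𝔜 n) (𝔜 (n + 1)) ^ 2 ≤ B n - B (n + 1) := fun n =>
    le_sub_iff_add_le.2 (sq_dist_add_le_of_mem_relaxedTB hρ (h n))
  have hanti : Antitone B := antitone_nat_of_succ_le fun n =>
    sub_nonneg.1 ((sq_nonneg _).trans (hB n))
  have hlim := tendsto_atTop_ciInf hanti ⟨0, by
    rintro _ ⟨n, rfl⟩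
    exact Finset.sum_nonneg fun i _ => mul_nonneg (hρ.1 i) (sq_nonneg _)⟩
  have hdiff : Tendsto (fun n => B n - B (n + 1)) atTop (𝓝 0) := by
    simpa only [sub_self] using hlim.sub ((tendsto_add_atTop_iff_nat 1).2 hlim)
  have hsq : Tendsto (fun n => dist (𝔜 n) (𝔜 (n + 1)) ^ 2) atTop (𝓝 0) :=
    squeeze_zero (fun _ => sq_nonneg _) hB hdiff
  simpa only [Real.sqrt_sq dist_nonneg, Real.sqrt_zero] using hsq.sqrt

theorem exists_family_toGM_eq (𝔜 : GM.{u}) (𝔛 : Fin N → GM.{u}) :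
    ∃ Z : Option (Fin N) → GMSpace.{u}, (Z none).toGM = 𝔜 ∧ ∀ i, (Z (some i)).toGM = 𝔛 i := by
  choose Z hZ using fun o : Option (Fin N) =>
    SeparationQuotient.surjective_mk (o.elim 𝔜 𝔛 : GM.{u})
  exact ⟨Z, hZ none, fun i => hZ (some i)⟩

theorem exists_jointPlan_toGM_mean_eq (hρ : ρ ∈ stdSimplex ℝ (Fin N)) {𝔜 ℨ : GM.{u}}
    (h : ℨ ∈ relaxedTB ρ 𝔛 𝔜) {Z : Option (Fin N) → GMSpace.{u}}
    (hZ : ∀ i, (Z (some i)).toGM = 𝔛 i) :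
    ∃ Γ : JointPlan Z, (Γ.mean ρ).toGM = ℨ ∧
      ∀ i, Γ.pairDist none (some i) ≤ dist 𝔜 (𝔛 i) + dist 𝔜 (Z none).toGM := by
  have := nonempty_of_mem_stdSimplex hρ
  obtain ⟨Z₀, Γ₀, rfl, hX, hΓ₀, rfl⟩ := exists_jointPlan_of_mem_relaxedTB h
  obtain ⟨Γ, hΓ⟩ := Γ₀.exists_gaugeClose_gw Z
  have hgw : ∀ i, gw (Z₀ (some i)) (Z (some i)) = 0 := fun i =>
    (toGM_eq_iff _ _).1 ((hX i).trans (hZ i).symm)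
  refine ⟨Γ, (dist_le_zero.1 ?_).symm, fun i => ?_⟩
  · calc dist (Γ₀.mean ρ).toGM (Γ.mean ρ).toGM
        ≤ ∑ i, ρ i * gw (Z₀ (some i)) (Z (some i)) := hΓ.gw_mean_le hρ.1
      _ = 0 := by simp only [hgw, mul_zero, Finset.sum_const_zero]
  · have hdist := hΓ.dist_pairDist_le none (some i)
    rw [hgw, add_zero, dist_comm, hΓ₀] at hdist
    rw [← hX i]
    exact sub_le_iff_le_add'.1 ((le_abs_self _).trans hdist)

theorem exists_isCompact_relaxedTB_subset (hρ : ρ ∈ stdSimplex ℝ (Fin N)) (𝔛 : Fin N → GM.{u}) :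
    ∃ K : Set GM.{u}, IsCompact K ∧ ∀ 𝔜, relaxedTB ρ 𝔛 𝔜 ⊆ K := by
  obtain ⟨i⟩ := nonempty_of_mem_stdSimplex hρ
  obtain ⟨Z, -, hZ⟩ := exists_family_toGM_eq (𝔛 i) 𝔛
  refine ⟨_, isCompact_range (continuous_toGM_mean hρ (Z := Z)), fun 𝔜 ℨ hℨ => ?_⟩
  obtain ⟨Γ, hΓ, -⟩ := exists_jointPlan_toGM_mean_eq hρ hℨ hZ
  exact ⟨Γ, hΓ⟩

theorem mem_relaxedTB_of_tendsto (hρ : ρ ∈ stdSimplex ℝ (Fin N)) {𝔜 ℨ : ℕ → GM.{u}}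
    {𝔜lim ℨlim : GM.{u}} (h : ∀ l, ℨ l ∈ relaxedTB ρ 𝔛 (𝔜 l)) (h𝔜 : Tendsto 𝔜 atTop (𝓝 𝔜lim))
    (hℨ : Tendsto ℨ atTop (𝓝 ℨlim)) : ℨlim ∈ relaxedTB ρ 𝔛 𝔜lim := by
  obtain ⟨Z, rfl, hZ⟩ := exists_family_toGM_eq 𝔜lim 𝔛
  obtain rfl : (fun i => (Z (some i)).toGM) = 𝔛 := funext hZ
  choose Γ hΓ hpair using fun l => exists_jointPlan_toGM_mean_eq hρ (h l) hZ
  obtain ⟨Γlim, ψ, hψ, hlim⟩ := CompactSpace.tendsto_subseq Γ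
  have hmean : (Γlim.mean ρ).toGM = ℨlim := by
    refine tendsto_nhds_unique (((continuous_toGM_mean hρ).tendsto Γlim).comp hlim) ?_
    simpa only [Function.comp_def, hΓ] using hℨ.comp hψ.tendsto_atTop
  have hopt : ∀ i, Γlim.pairDist none (some i) = gw (Z none) (Z (some i)) := fun i => by
    refine le_antisymm ?_ (Γlim.gw_le_pairDist none (some i))
    have hbound : Tendsto (fun l => dist (𝔜 l) (Z (some i)).toGM + dist (𝔜 l) (Z none).toGM)
        atTop (𝓝 (dist (Z none).toGM (Z (some i)).toGM)) := by
      simpa only [add_zero] using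
        (h𝔜.dist tendsto_const_nhds).add (tendsto_iff_dist_tendsto_zero.1 h𝔜)
    exact le_of_tendsto_of_tendsto'
      (((continuous_pairDist none (some i)).tendsto Γlim).comp hlim)
      (hbound.comp hψ.tendsto_atTop) fun l => hpair (ψ l) i
  exact hmean ▸ toGM_mean_mem_relaxedTB hopt

end GMSpace

theorem theorem6p3 {N : ℕ} (𝔛 : Fin N → GM.{u}) (ρ : Fin N → ℝ) (hρ : ρ ∈ stdSimplex ℝ (Fin N))
    (𝔜 : ℕ → GM.{u}) (h𝔜 : ∀ n, 𝔜 (n + 1) ∈ relaxedTB ρ 𝔛 (𝔜 n))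
    (φ : ℕ → ℕ) (hφ : StrictMono φ) :
    ∃ ψ : ℕ → ℕ, StrictMono ψ ∧ ∃ 𝔜lim : GM.{u},
      Tendsto (fun l => 𝔜 (φ (ψ l))) atTop (𝓝 𝔜lim) ∧ 𝔜lim ∈ relaxedTB ρ 𝔛 𝔜lim := by
  obtain ⟨K, hK, hTB⟩ := GMSpace.exists_isCompact_relaxedTB_subset hρ 𝔛
  obtain ⟨𝔜lim, -, ψ, hψ, hsucc⟩ := hK.tendsto_subseq fun l => hTB _ (h𝔜 (φ l))
  have hdist : Tendsto (fun l => dist (𝔜 (φ (ψ l) + 1)) (𝔜 (φ (ψ l)))) atTop (𝓝 0) := by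
    simpa only [dist_comm, Function.comp_def] using
      (GMSpace.tendsto_dist_succ_of_mem_relaxedTB hρ h𝔜).comp (hφ.comp hψ).tendsto_atTop
  have hlim : Tendsto (fun l => 𝔜 (φ (ψ l))) atTop (𝓝 𝔜lim) := hsucc.congr_dist hdist
  exact ⟨ψ, hψ, 𝔜lim, hlim, GMSpace.mem_relaxedTB_of_tendsto hρ (fun l => h𝔜 _) hlim hsucc⟩
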